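/- Let $\alpha\in\mathbb{R}$ and $B_0>0$. On $\mathbb{R}^2\setminus\{0\}$ put $$A_B(x)=\alpha\Big(-\frac{x_2}{|x|^2},\frac{x_1}{|x|^2}\Big),\qquad A_{\mathrm{hmf}}(x)=\frac{B_0}{2}(-x_2,x_1),\qquad \nabla_{\alpha,B_0}=\nabla+i(A_B+A_{\mathrm{hmf}}).$$ Let $H_{\alpha,B_0}=-(\nabla+i(A_B+A_{\mathrm{hmf}}))^2$ be the Friedrichs extension from $C_c^\infty(\mathbb{R}^2\setminus\{0\};\mathbb{C})$, that is, the non-negative self-adjoint operator on $L^2(\mathbb{R}^2;\mathbb{C})$ of the quadratic form $Q(u)=\int_{\mathbb{R}^2}|\nabla_{\alpha,B_0}u|^2\,dx$, whose domain is the completion of $C_c^\infty(\mathbb{R}^2\setminus\{0\};\mathbb{C})$ in the form norm $(\|u\|_{L^2}^2+Q(u))^{1/2}$. Let $e^{-tH_{\alpha,B_0}}$, $t>0$, be its heat semigroup, defined by the functional calculus. Proposition (Davies–Gaffney inequality). Let $A$ and $B$ be disjoint measurable sets in $\mathbb{R}^2$, and let $f,g\in L^2(\mathbb{R}^2;\mathbb{C})$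 be such that $f=0$ almost everywhere outside $A$ and $g=0$ almost everywhere outside $B$. Then for all $t>0$ $$|\langle e^{-tH_{\alpha,B_0}}f,g\rangle|\le \|f\|_{L^2(A)}\,\|g\|_{L^2(B)}\,e^{-\frac{d(A,B)^2}{4t}},$$ where $\langle\cdot,\cdot\rangle$ is the inner product of $L^2(\mathbb{R}^2;\mathbb{C})$ and $d(A,B)=\inf\{|x-y|: x\in A,\ y\in B\}$ (if $A$ or $B$ is empty, both sides are $0$). -/

import Mathlib

open MeasureTheory TopologicalSpace
open scoped ENNReal Distributions InnerProductSpace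

noncomputable section

namespace AharonovBohm

/-- The Euclidean plane `ℝ²`. -/
abbrev Plane : Type := EuclideanSpace ℝ (Fin 2)

/-- The Hilbert space `L²(ℝ²; ℂ)`. -/
abbrev L2 : Type := Lp ℂ 2 (volume : Measure Plane)

/-- The Hilbert space `L²(ℝ²; ℂ²)` of square integrable complex vector fields. -/
abbrev L2Vec : Type := Lp (EuclideanSpace ℂ (Fin 2)) 2 (volume : Measure Plane)

/-- The punctured plane `ℝ² ∖ {0}` as an open set; `𝓓(puncturedPlane, ℂ)` is
`C_c^∞(ℝ² ∖ {0}; ℂ)`. -/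
def puncturedPlane : Opens Plane := ⟨{0}ᶜ, isOpen_compl_singleton⟩

/-- The Aharonov–Bohm potential `α (-x₂, x₁) / |x|²`. -/
def abPotential (α : ℝ) (x : Plane) : Plane :=
  !₂[-(α * x 1 / ‖x‖ ^ 2), α * x 0 / ‖x‖ ^ 2]

/-- The potential `(B₀ / 2) (-x₂, x₁)` of the homogeneous magnetic field `B₀`. -/
def hmfPotential (B₀ : ℝ) (x : Plane) : Plane :=
  !₂[-(B₀ / 2 * x 1), B₀ / 2 * x 0]

/-- The full magnetic potential `A_B + A_hmf`. -/
def potential (α B₀ : ℝ) (x : Plane) : Plane :=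
  abPotential α x + hmfPotential B₀ x

/-- The magnetic gradient `∇φ + i (A_B + A_hmf) φ`. -/
def magneticGradient (α B₀ : ℝ) (φ : Plane → ℂ) (x : Plane) : EuclideanSpace ℂ (Fin 2) :=
  WithLp.toLp 2 fun k =>
    fderiv ℝ φ x (EuclideanSpace.single k 1) + Complex.I * (potential α B₀ x k : ℂ) * φ x

lemma continuousAt_potential (α B₀ : ℝ) {x : Plane} (hx : x ≠ 0) (k : Fin 2) :
    ContinuousAt (fun y => potential α B₀ y k) x := by
  have hn : ‖x‖ ^ 2 ≠ 0 := by simpa using hx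
  fin_cases k
  · simp only [potential, abPotential, hmfPotential]
    simp
    fun_prop (disch := simpa using hx)
  · simp only [potential, abPotential, hmfPotential]
    simp
    fun_prop (disch := simpa using hx)

lemma tsupport_magneticGradient_subset (α B₀ : ℝ) (φ : Plane → ℂ) :
    tsupport (magneticGradient α B₀ φ) ⊆ tsupport φ := by
  refine closure_minimal (fun x hx => ?_) (isClosed_tsupport φ)
  by_contra hxs
  apply hx
  have h1 : fderiv ℝ φ x = 0 := by
    by_contra h
    exact hxs (support_fderiv_subset ℝ h)
  have h2 : φ x = 0 := image_eq_zero_of_notMem_tsupport hxs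
  ext k
  simp [magneticGradient, h1, h2]

lemma continuous_magneticGradient (α B₀ : ℝ) (φ : 𝓓(puncturedPlane, ℂ)) :
    Continuous (magneticGradient α B₀ φ) := by
  refine continuous_of_tsupport fun x hx => ?_
  have hx0 : x ≠ 0 := φ.tsupport_subset (tsupport_magneticGradient_subset α B₀ φ hx)
  have hA := continuousAt_potential α B₀ hx0
  have hd : Continuous (fderiv ℝ φ) := φ.contDiff.continuous_fderiv (by simp)
  refine (PiLp.continuous_toLp 2 _).continuousAt.comp (continuousAt_pi.2 fun k => ?_)
  refine ContinuousAt.add (by fun_prop) ((continuousAt_const.mul ?_).mul φ.continuous.continuousAt)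
  exact Complex.continuous_ofReal.continuousAt.comp (hA k)

lemma memLp_testFunction (φ : 𝓓(puncturedPlane, ℂ)) :
    MemLp φ 2 (volume : Measure Plane) :=
  φ.continuous.memLp_of_hasCompactSupport φ.hasCompactSupport

lemma memLp_magneticGradient (α B₀ : ℝ) (φ : 𝓓(puncturedPlane, ℂ)) :
    MemLp (magneticGradient α B₀ φ) 2 (volume : Measure Plane) :=
  (continuous_magneticGradient α B₀ φ).memLp_of_hasCompactSupport
    (φ.hasCompactSupport.of_isClosed_subset (isClosed_tsupport _)
      (tsupport_magneticGradient_subset α B₀ φ))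

lemma magneticGradient_add (α B₀ : ℝ) (φ ψ : 𝓓(puncturedPlane, ℂ)) :
    magneticGradient α B₀ (φ + ψ : 𝓓(puncturedPlane, ℂ)) =
      magneticGradient α B₀ φ + magneticGradient α B₀ ψ := by
  have h1 : Differentiable ℝ φ := φ.contDiff.differentiable (by simp)
  have h2 : Differentiable ℝ ψ := ψ.contDiff.differentiable (by simp)
  ext x k
  have h : (⇑(φ + ψ) : Plane → ℂ) = ⇑φ + ⇑ψ := rfl
  simp only [magneticGradient, h, fderiv_add (h1 x) (h2 x), Pi.add_apply, PiLp.add_apply,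
    add_apply]
  ring

lemma magneticGradient_smul (α B₀ : ℝ) (c : ℂ) (φ : 𝓓(puncturedPlane, ℂ)) :
    magneticGradient α B₀ (c • φ : 𝓓(puncturedPlane, ℂ)) = c • magneticGradient α B₀ φ := by
  have h1 : Differentiable ℝ φ := φ.contDiff.differentiable (by simp)
  ext x k
  have h : (⇑(c • φ) : Plane → ℂ) = c • ⇑φ := rfl
  simp only [magneticGradient, h, fderiv_const_smul (h1 x), Pi.smul_apply, PiLp.smul_apply,
    smul_apply, smul_eq_mul]
  ring

/-- The map `φ ↦ (φ, ∇φ + i (A_B + A_hmf) φ)` from `C_c^∞(ℝ² ∖ {0}; ℂ)` to the Hilbert sum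
`L²(ℝ²; ℂ) ⊕ L²(ℝ²; ℂ²)`. -/
def gradientGraphMap (α B₀ : ℝ) : 𝓓(puncturedPlane, ℂ) →ₗ[ℂ] WithLp 2 (L2 × L2Vec) where
  toFun φ := WithLp.toLp 2
    ((memLp_testFunction φ).toLp φ, (memLp_magneticGradient α B₀ φ).toLp _)
  map_add' φ ψ := by
    rw [← WithLp.toLp_add, Prod.mk_add_mk, ← MemLp.toLp_add, ← MemLp.toLp_add]
    congr 3
    exact magneticGradient_add α B₀ φ ψ
  map_smul' c φ := by
    rw [RingHom.id_apply, ← WithLp.toLp_smul, Prod.smul_mk, ← MemLp.toLp_const_smul,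
      ← MemLp.toLp_const_smul]
    congr 3
    exact magneticGradient_smul α B₀ c φ

/-- The form domain `𝓗¹_{α,B₀}`: the completion of `C_c^∞(ℝ² ∖ {0}; ℂ)` for the norm
`(‖φ‖² + ‖∇φ + i (A_B + A_hmf) φ‖²)^{1/2}`, realized as the closure in
`L²(ℝ²; ℂ) ⊕ L²(ℝ²; ℂ²)` of the graph of the magnetic gradient. An element is a pair `(u, p)`, where
`p` is the magnetic gradient of `u`. -/
def formDomain (α B₀ : ℝ) : Submodule ℂ (WithLp 2 (L2 × L2Vec)) :=
  (LinearMap.range (gradientGraphMap α B₀)).topologicalClosure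

instance (α B₀ : ℝ) : CompleteSpace (formDomain α B₀) :=
  inferInstanceAs (CompleteSpace (LinearMap.range (gradientGraphMap α B₀)).topologicalClosure)

/-- The graph of the operator of the closed quadratic form `Q(u) = ∫ |∇u + i (A_B + A_hmf) u|²` with
domain `𝓗¹_{α,B₀}`, that is, of the Friedrichs extension: it holds all pairs `(u, w)` of `L²`
functions with `u ∈ 𝓗¹_{α,B₀}` and `Q(v, u) = ⟨v, w⟩` for all `v ∈ 𝓗¹_{α,B₀}`. -/
def hamiltonianGraph (α B₀ : ℝ) : Submodule ℂ (L2 × L2) where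
  carrier := {z | ∃ U ∈ formDomain α B₀, U.fst = z.1 ∧
    ∀ V ∈ formDomain α B₀, ⟪V.snd, U.snd⟫_ℂ = ⟪V.fst, z.2⟫_ℂ}
  zero_mem' := ⟨0, zero_mem _, rfl, fun V _ => by simp⟩
  add_mem' := by
    rintro a b ⟨U, hU, hUa, h1⟩ ⟨W, hW, hWb, h2⟩
    refine ⟨U + W, add_mem hU hW, by simp [hUa, hWb], fun V hV => ?_⟩
    simp [inner_add_right, h1 V hV, h2 V hV]
  smul_mem' := by
    rintro c a ⟨U, hU, hUa, h1⟩
    refine ⟨c • U, Submodule.smul_mem _ c hU, by simp [hUa], fun V hV => ?_⟩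
    simp only [WithLp.smul_snd, Prod.smul_snd, inner_smul_right, h1 V hV]

/-- The Hamiltonian `H_{α,B₀} = -(∇ + i (A_B + A_hmf))²`, as the Friedrichs extension from
`C_c^∞(ℝ² ∖ {0}; ℂ)`: an unbounded operator on `L²(ℝ²; ℂ)`. -/
def hamiltonian (α B₀ : ℝ) : L2 →ₗ.[ℂ] L2 := (hamiltonianGraph α B₀).toLinearPMap

/-- The inclusion of the form domain `𝓗¹_{α,B₀}` into `L²`. -/
def formInclusion (α B₀ : ℝ) : formDomain α B₀ →L[ℂ] L2 :=
  (WithLp.fstL 2 ℂ L2 L2Vec).comp (formDomain α B₀).subtypeL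

/-- The resolvent `(1 + H_{α,B₀})⁻¹`. By the Riesz representation theorem (the adjoint of the
inclusion of the form domain), it sends `f` to the solution `u ∈ 𝓗¹_{α,B₀}` of
`⟨v, u⟩ + Q(v, u) = ⟨v, f⟩` for all `v ∈ 𝓗¹_{α,B₀}`; see `resolvent_hamiltonian` and
`hamiltonian_resolvent`. -/
def resolvent (α B₀ : ℝ) : L2 →L[ℂ] L2 :=
  formInclusion α B₀ ∘L ContinuousLinearMap.adjoint (formInclusion α B₀)

lemma isSelfAdjoint_resolvent (α B₀ : ℝ) : IsSelfAdjoint (resolvent α B₀) := by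
  rw [ContinuousLinearMap.isSelfAdjoint_iff', resolvent, ContinuousLinearMap.adjoint_comp,
    ContinuousLinearMap.adjoint_adjoint]

lemma mem_hamiltonianGraph_iff (α B₀ : ℝ) (u w : L2) :
    (u, w) ∈ hamiltonianGraph α B₀ ↔ resolvent α B₀ (u + w) = u := by
  constructor
  · rintro ⟨U, hU, hUu, h⟩
    have key : ContinuousLinearMap.adjoint (formInclusion α B₀) (u + w) = ⟨U, hU⟩ := by
      refine ext_inner_left ℂ fun V => ?_
      rw [ContinuousLinearMap.adjoint_inner_right, Submodule.coe_inner, WithLp.prod_inner_apply]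
      have h1 := h V V.2
      change ⟪(V : WithLp 2 (L2 × L2Vec)).fst, u + w⟫_ℂ =
        ⟪(V : WithLp 2 (L2 × L2Vec)).fst, U.fst⟫_ℂ + ⟪(V : WithLp 2 (L2 × L2Vec)).snd, U.snd⟫_ℂ
      rw [h1, hUu, inner_add_right]
    rw [resolvent, ContinuousLinearMap.comp_apply, key]
    exact hUu
  · intro h
    set U := ContinuousLinearMap.adjoint (formInclusion α B₀) (u + w) with hU
    refine ⟨U, U.2, h, fun V hV => ?_⟩
    have h1 := ContinuousLinearMap.adjoint_inner_right (formInclusion α B₀) ⟨V, hV⟩ (u + w)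
    rw [← hU, Submodule.coe_inner, WithLp.prod_inner_apply] at h1
    change ⟪V.fst, (U : WithLp 2 (L2 × L2Vec)).fst⟫_ℂ +
      ⟪V.snd, (U : WithLp 2 (L2 × L2Vec)).snd⟫_ℂ = ⟪V.fst, u + w⟫_ℂ at h1
    have h2 : (U : WithLp 2 (L2 × L2Vec)).fst = u := h
    rw [h2, inner_add_right] at h1
    exact add_left_cancel h1

/-- `C_c^∞(ℝ² ∖ {0}; ℂ)` has trivial orthogonal complement in `L²`. -/
lemma eq_zero_of_inner_testFunction (w : L2)
    (h : ∀ φ : 𝓓(puncturedPlane, ℂ), ⟪(memLp_testFunction φ).toLp φ, w⟫_ℂ = 0) : w = 0 := by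
  have hloc : LocallyIntegrable w (volume : Measure Plane) :=
    (Lp.memLp w).locallyIntegrable (by norm_num)
  have h0 : ∀ᵐ x ∂(volume : Measure Plane), x ∈ ({0}ᶜ : Set Plane) → w x = 0 := by
    refine isOpen_compl_singleton.ae_eq_zero_of_integral_contDiff_smul_eq_zero
      (hloc.locallyIntegrableOn _) fun g hg hgc hgs => ?_
    let φ : 𝓓(puncturedPlane, ℂ) :=
      ⟨fun x => (g x : ℂ), Complex.ofRealCLM.contDiff.comp hg,
        hgc.comp_left (g := Complex.ofReal) rfl,
        (closure_mono (Function.support_comp_subset (g := Complex.ofReal) rfl g)).trans hgs⟩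
    have hφ : ∀ x, φ x = (g x : ℂ) := fun x => rfl
    have h1 := h φ
    rw [L2.inner_def] at h1
    rw [← h1]
    refine integral_congr_ae ?_
    filter_upwards [(memLp_testFunction φ).coeFn_toLp] with x hx
    rw [hx]
    simp [hφ, mul_comm]
  rw [Lp.eq_zero_iff_ae_eq_zero]
  have h2 : ∀ᵐ x ∂(volume : Measure Plane), x ∈ ({0}ᶜ : Set Plane) :=
    compl_mem_ae_iff.2 (measure_singleton 0)
  filter_upwards [h0, h2] with x hx hx2 using hx hx2

lemma hamiltonianGraph_functional (α B₀ : ℝ) :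
    ∀ z ∈ hamiltonianGraph α B₀, z.1 = 0 → z.2 = 0 := by
  rintro ⟨u, w⟩ hz (rfl : u = 0)
  have h := (mem_hamiltonianGraph_iff α B₀ 0 w).1 hz
  rw [zero_add] at h
  have h1 : ContinuousLinearMap.adjoint (formInclusion α B₀) w = 0 := by
    rw [← inner_self_eq_zero (𝕜 := ℂ), ContinuousLinearMap.adjoint_inner_left]
    change ⟪w, resolvent α B₀ w⟫_ℂ = 0
    rw [h, inner_zero_right]
  refine eq_zero_of_inner_testFunction w fun φ => ?_
  have h2 := ContinuousLinearMap.adjoint_inner_right (formInclusion α B₀)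
    ⟨gradientGraphMap α B₀ φ, Submodule.le_topologicalClosure _ (LinearMap.mem_range_self _ φ)⟩ w
  rw [h1, inner_zero_right] at h2
  exact h2.symm

lemma graph_hamiltonian (α B₀ : ℝ) : (hamiltonian α B₀).graph = hamiltonianGraph α B₀ :=
  Submodule.toLinearPMap_graph_eq _ (hamiltonianGraph_functional α B₀)

/-- `(1 + H)⁻¹ (1 + H) u = u` for all `u` in the domain of `H`. -/
lemma resolvent_hamiltonian (α B₀ : ℝ) (u : (hamiltonian α B₀).domain) :
    resolvent α B₀ (u + hamiltonian α B₀ u) = u := by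
  rw [← mem_hamiltonianGraph_iff, ← graph_hamiltonian]
  exact LinearPMap.mem_graph _ u

/-- `(1 + H)⁻¹ f` lies in the domain of `H` and `(1 + H) (1 + H)⁻¹ f = f` for all `f ∈ L²`. -/
lemma hamiltonian_resolvent (α B₀ : ℝ) (f : L2) :
    ∃ h : resolvent α B₀ f ∈ (hamiltonian α B₀).domain,
      resolvent α B₀ f + hamiltonian α B₀ ⟨resolvent α B₀ f, h⟩ = f := by
  have h : (resolvent α B₀ f, f - resolvent α B₀ f) ∈ (hamiltonian α B₀).graph := by
    rw [graph_hamiltonian, mem_hamiltonianGraph_iff, add_sub_cancel]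
  obtain ⟨y, hy1, hy2⟩ := (LinearPMap.mem_graph_iff _).1 h
  simp only at hy1 hy2
  have hd : resolvent α B₀ f ∈ (hamiltonian α B₀).domain := hy1 ▸ y.2
  refine ⟨hd, ?_⟩
  have : (⟨resolvent α B₀ f, hd⟩ : (hamiltonian α B₀).domain) = y := Subtype.ext hy1.symm
  rw [this, hy2, add_sub_cancel]

/-- The function `λ ↦ e^{-tλ}` of `λ = 1/r - 1 ≥ 0` in the variable `r = 1/(1 + λ) ∈ (0, 1]`,
with its limit value `0` at `r = 0`. -/
def heatMultiplier (t r : ℝ) : ℝ := if r ≤ 0 then 0 else Real.exp (-(t * (r⁻¹ - 1)))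

lemma continuous_heatMultiplier {t : ℝ} (ht : 0 < t) : Continuous (heatMultiplier t) := by
  have h : heatMultiplier t = fun r => Real.exp t * expNegInvGlue (r / t) := by
    funext r
    by_cases hr : r ≤ 0
    · simp [heatMultiplier, hr, expNegInvGlue.zero_of_nonpos (div_nonpos_of_nonpos_of_nonneg hr ht.le)]
    · have hr' : ¬ r / t ≤ 0 := not_le.2 (div_pos (not_le.1 hr) ht)
      rw [heatMultiplier, if_neg hr, expNegInvGlue, if_neg hr', ← Real.exp_add]
      congr 1
      rw [inv_div]
      ring
  rw [h]
  exact continuous_const.mul ((expNegInvGlue.contDiff (n := 0)).continuous.comp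
    (continuous_id.div_const t))

/-- For `t > 0` and a self-adjoint operator `T ≥ 0` on a Hilbert space, given through its resolvent
`R = (1 + T)⁻¹`, the operator `e^{-tT}` by the functional calculus: a function `F(T)` of `T` is the
function `r ↦ F(1/r - 1)` of the bounded self-adjoint operator `R`. -/
def expNeg {E : Type*} [NormedAddCommGroup E] [InnerProductSpace ℂ E] [CompleteSpace E]
    (R : E →L[ℂ] E) (t : ℝ) : E →L[ℂ] E :=
  cfc (heatMultiplier t) R

/-- The heat semigroup `e^{-tH_{α,B₀}}`, `t > 0`. -/
def heatSemigroup (α B₀ t : ℝ) : L2 →L[ℂ] L2 := expNeg (resolvent α B₀) t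

/-- The distance `d(A, B) = inf {|x - y| : x ∈ A, y ∈ B}` of two sets. -/
def setDist (A B : Set Plane) : ℝ := sInf {ρ | ∃ x ∈ A, ∃ y ∈ B, ρ = dist x y}

/-- The norm of (the restriction of) `f` in `L²(A)`. -/
def normOn (A : Set Plane) (f : L2) : ℝ := (eLpNorm f 2 (volume.restrict A)).toReal

end AharonovBohm

end

/-!
The proof is Davies' exponential perturbation method, run on the backward Euler scheme instead of
on the heat equation, so that no regularity of `t ↦ e^{-tH} f` is needed.

Let `φ` be a bounded smooth real function with `|∇φ| ≤ s`. The form domain is stable under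
multiplication by `e^{2φ}` (`exists_formDomain_mul`), so `e^{2φ} u` is an admissible test function
in the weak form of `H u = w`. With `p` the magnetic gradient of `u`, completing the square gives
`Re Q(e^{2φ} u, u) = ∫ e^{2φ} (|p + u ∇φ|² - |∇φ|² |u|²) ≥ -s² ‖e^φ u‖²`
(`neg_le_re_inner_expWeight`). The potential is a term of order zero in the magnetic gradient, so
it does not enter the product rule and plays no further role.
Applied to `u = (1 + τ H)⁻¹ h` this yields `(1 - τ s²) ‖e^φ u‖ ≤ ‖e^φ h‖`
(`norm_expWeight_eulerStep_le`).

On the spectrum, `(1 + t λ / n)⁻ⁿ` converges to `e^{-tλ}` uniformly in `λ ≥ 0`, with error at most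
`2 / (n - 1)`. Hence `(1 + (t/n) H)⁻ⁿ → e^{-tH}` in operator norm (`tendsto_eulerStep_pow`), and
iterating the resolvent bound gives `‖e^φ e^{-tH} f‖ ≤ e^{s² t} ‖e^φ f‖`
(`norm_expWeight_heatSemigroup_le`).

Finally take `φ = s η`, where `η` is a mollification, at distance at most `ε`, of
`min (dist(·, A), d(A, B))`. Writing `⟨g, e^{-tH} f⟩ = ⟨e^{-φ} g, e^φ e^{-tH} f⟩` bounds this by
`‖f‖ ‖g‖ e^{s² t - s d + 2 s ε}`; let `ε → 0` and choose `s = d / (2t)`.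
-/

noncomputable section

namespace AharonovBohm

/-! ### The backward Euler scheme in the functional calculus -/

/-- The function `λ ↦ (1 + τ λ)⁻¹` of `λ = 1/r - 1` in the variable `r = 1/(1 + λ)`. -/
def eulerMultiplier (τ r : ℝ) : ℝ := r / (r + τ * (1 - r))

lemma eulerMultiplier_denom_pos {τ r : ℝ} (hτ : 0 < τ) (h0 : 0 ≤ r) (h1 : r ≤ 1) :
    0 < r + τ * (1 - r) := by
  rcases h0.eq_or_lt with rfl | h
  · simpa using hτ
  · have := mul_nonneg hτ.le (sub_nonneg.2 h1)
    linarith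

lemma continuousOn_eulerMultiplier {τ : ℝ} (hτ : 0 < τ) :
    ContinuousOn (eulerMultiplier τ) (Set.Icc 0 1) := by
  unfold eulerMultiplier
  exact ContinuousOn.div (by fun_prop) (by fun_prop)
    fun r hr => (eulerMultiplier_denom_pos hτ hr.1 hr.2).ne'

/-- The backward Euler scheme for the exponential, with a rate uniform in `x ≥ 0`. -/
lemma abs_exp_neg_sub_one_add_div_pow_le {x : ℝ} (hx : 0 ≤ x) {n : ℕ} (hn : 2 ≤ n) :
    |Real.exp (-x) - ((1 + x / n)⁻¹) ^ n| ≤ 2 / (n - 1) := by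
  have hn' : (2 : ℝ) ≤ n := by exact_mod_cast hn
  set y := x / n with hy
  have hy0 : 0 ≤ y := by positivity
  have hx' : x = n * y := by rw [hy]; field_simp
  have he : Real.exp (-x) = Real.exp (-y) ^ n := by
    rw [← Real.exp_nat_mul, hx']; ring_nf
  set b := (1 + y)⁻¹ with hb
  have hb0 : 0 < b := by positivity
  have hab : Real.exp (-y) ≤ b := by
    rw [Real.exp_neg, hb]
    gcongr
    linarith [Real.add_one_le_exp y]
  -- From `e^{-y} ≥ 1 - y` and `(1 + y)⁻¹ - (1 - y) = y² (1 + y)⁻¹`.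
  have hba : b - Real.exp (-y) ≤ y ^ 2 * b := by
    have h1 : b * (1 + y) = 1 := inv_mul_cancel₀ (by positivity)
    nlinarith [Real.one_sub_le_exp_neg y]
  have hpow : b ^ n - Real.exp (-y) ^ n ≤ n * (y ^ 2 * b ^ n) := by
    have h1 : b ^ n - Real.exp (-y) ^ n =
        (b - Real.exp (-y)) * ∑ i ∈ Finset.range n, b ^ i * Real.exp (-y) ^ (n - 1 - i) := by
      rw [mul_comm]; exact (Commute.all _ _).geom_sum₂_mul n |>.symm
    have h2 : ∑ i ∈ Finset.range n, b ^ i * Real.exp (-y) ^ (n - 1 - i) ≤ n * b ^ (n - 1) := by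
      calc _ ≤ ∑ i ∈ Finset.range n, b ^ (n - 1) := by
            refine Finset.sum_le_sum fun i hi => ?_
            have hi' := Finset.mem_range.1 hi
            calc b ^ i * Real.exp (-y) ^ (n - 1 - i) ≤ b ^ i * b ^ (n - 1 - i) := by gcongr
              _ = b ^ (n - 1) := by rw [← pow_add]; congr 1; omega
        _ = _ := by simp
    rw [h1]
    calc _ ≤ (y ^ 2 * b) * (n * b ^ (n - 1)) := by
          refine mul_le_mul hba h2 ?_ (by positivity)
          exact Finset.sum_nonneg fun i _ => by positivity
      _ = n * (y ^ 2 * (b ^ (n - 1) * b)) := by ring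
      _ = _ := by rw [← pow_succ]; congr 4; omega
  -- The quadratic term of the binomial expansion absorbs the factor `y²`.
  have hbin : (n * (n - 1) / 2 : ℝ) * y ^ 2 ≤ (1 + y) ^ n := by
    rw [add_comm, add_pow]
    refine le_trans (le_of_eq ?_) (Finset.single_le_sum (s := Finset.range (n + 1))
      (f := fun m => y ^ m * 1 ^ (n - m) * (n.choose m : ℝ)) (fun i _ => by positivity)
      (Finset.mem_range.2 (by omega : 2 < n + 1)))
    simp only [one_pow, mul_one, Nat.cast_choose_two]
    ring
  have hbn : (1 + y) ^ n * b ^ n = 1 := by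
    rw [← mul_pow, hb, mul_inv_cancel₀ (by positivity), one_pow]
  have hfin : n * (y ^ 2 * b ^ n) ≤ 2 / (n - 1) := by
    rw [le_div_iff₀ (by linarith)]
    have := mul_le_mul_of_nonneg_right hbin (pow_pos hb0 n).le
    rw [hbn] at this
    linarith
  have hle : Real.exp (-y) ^ n ≤ b ^ n := by gcongr
  rw [he, abs_sub_comm, abs_of_nonneg (sub_nonneg.2 hle)]
  exact hpow.trans hfin

lemma abs_heatMultiplier_sub_le {t r : ℝ} (ht : 0 < t) (h0 : 0 ≤ r) (h1 : r ≤ 1) {n : ℕ}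
    (hn : 2 ≤ n) :
    |heatMultiplier t r - eulerMultiplier (t / n) r ^ n| ≤ 2 / (n - 1) := by
  have hn' : (2 : ℝ) ≤ n := by exact_mod_cast hn
  rcases h0.eq_or_lt with rfl | h
  · rw [heatMultiplier, if_pos le_rfl, eulerMultiplier, zero_div, zero_pow (by omega)]
    simp only [sub_self, abs_zero]
    exact div_nonneg zero_le_two (by linarith)
  · have hl : 0 ≤ r⁻¹ - 1 := sub_nonneg.2 ((one_le_inv₀ h).2 h1)
    have he : eulerMultiplier (t / n) r = (1 + t * (r⁻¹ - 1) / n)⁻¹ := by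
      rw [eulerMultiplier, ← inv_div]
      congr 1
      field_simp
    rw [heatMultiplier, if_neg (not_le.2 h), he]
    exact abs_exp_neg_sub_one_add_div_pow_le (by positivity) hn

section Euler

variable {E : Type*} [NormedAddCommGroup E] [InnerProductSpace ℂ E] [CompleteSpace E]

/-- For a self-adjoint operator `T ≥ 0` given through its resolvent `R = (1 + T)⁻¹`, the operator
`(1 + τ T)⁻¹`. -/
def eulerStep (R : E →L[ℂ] E) (τ : ℝ) : E →L[ℂ] E := cfc (eulerMultiplier τ) R

/-- `e^{-tT}` is the limit of `(1 + (t/n) T)⁻ⁿ` in operator norm. -/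
lemma tendsto_eulerStep_pow {R : E →L[ℂ] E} (hR : IsSelfAdjoint R)
    (hs : spectrum ℝ R ⊆ Set.Icc 0 1) {t : ℝ} (ht : 0 < t) :
    Filter.Tendsto (fun n : ℕ => eulerStep R (t / n) ^ n) Filter.atTop (nhds (expNeg R t)) := by
  have hc : ∀ n : ℕ, 2 ≤ n → ContinuousOn (eulerMultiplier (t / n)) (spectrum ℝ R) := fun n hn =>
    (continuousOn_eulerMultiplier (div_pos ht (by positivity))).mono hs
  have h : Filter.Tendsto (fun n : ℕ => cfc (fun r => eulerMultiplier (t / n) r ^ n) R)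
      Filter.atTop (nhds (cfc (heatMultiplier t) R)) := by
    refine tendsto_cfc_fun ?_ ?_
    · rw [Metric.tendstoUniformlyOn_iff]
      intro ε hε
      have hlim : Filter.Tendsto (fun n : ℕ => 2 / ((n : ℝ) - 1)) Filter.atTop (nhds 0) :=
        Filter.Tendsto.div_atTop tendsto_const_nhds
          (Filter.tendsto_atTop_add_const_right _ (-1) tendsto_natCast_atTop_atTop)
      filter_upwards [hlim.eventually (gt_mem_nhds hε), Filter.eventually_ge_atTop 2]
        with n h1 h2 r hr
      exact (abs_heatMultiplier_sub_le ht (hs hr).1 (hs hr).2 h2).trans_lt h1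
    · filter_upwards [Filter.eventually_ge_atTop 2] with n hn
      exact (hc n hn).pow n
  refine h.congr' ?_
  filter_upwards [Filter.eventually_ge_atTop 2] with n hn
  exact cfc_pow _ n R (hc n hn)

/-- The equation `(1 + τ T) (1 + τ T)⁻¹ = 1`, expressed through `R = (1 + T)⁻¹`. -/
lemma eulerStep_spec {R : E →L[ℂ] E} (hR : IsSelfAdjoint R)
    (hs : spectrum ℝ R ⊆ Set.Icc 0 1) {τ : ℝ} (hτ : 0 < τ) (h : E) :
    R (eulerStep R τ h) + (τ : ℂ) • (eulerStep R τ h - R (eulerStep R τ h)) = R h := by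
  have hc := (continuousOn_eulerMultiplier hτ).mono hs
  have h1 : cfc (fun r : ℝ => r + τ * (1 - r)) R = R + τ • (1 - R) := by
    rw [cfc_add _ _ _, cfc_id' ℝ R, cfc_const_mul _ _ _, cfc_sub _ _ _, cfc_const_one ℝ R,
      cfc_id' ℝ R]
  have h2 : (R + τ • (1 - R)) * eulerStep R τ = R := by
    rw [← h1, eulerStep, ← cfc_mul _ _ R (by fun_prop) hc]
    conv_rhs => rw [← cfc_id' ℝ R]
    refine cfc_congr fun r hr => ?_
    have := (eulerMultiplier_denom_pos hτ (hs hr).1 (hs hr).2).ne'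
    simp only [eulerMultiplier]
    field_simp
  have h3 := congrArg (fun T : E →L[ℂ] E => T h) h2
  simpa using h3

lemma spectrum_subset_Icc_of_isPositive {R : E →L[ℂ] E} (hR : R.IsPositive) (hR1 : ‖R‖ ≤ 1) :
    spectrum ℝ R ⊆ Set.Icc 0 1 := by
  intro r hr
  refine ⟨spectrum_nonneg_of_nonneg ((ContinuousLinearMap.nonneg_iff_isPositive R).2 hR) hr, ?_⟩
  have hsa : IsSelfAdjoint R := hR.isSelfAdjoint
  have h2 := norm_apply_le_norm_cfc (fun x : ℝ => x) R hr
  rw [cfc_id' ℝ R] at h2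
  exact (le_abs_self r).trans (h2.trans hR1)

end Euler

/-! ### The resolvent of the Hamiltonian -/

lemma norm_formInclusion_le (α B₀ : ℝ) : ‖formInclusion α B₀‖ ≤ 1 :=
  ContinuousLinearMap.opNorm_le_bound _ zero_le_one fun U => by
    rw [one_mul]
    exact WithLp.norm_fst_le L2 (U : WithLp 2 (L2 × L2Vec))

lemma spectrum_resolvent_subset (α B₀ : ℝ) : spectrum ℝ (resolvent α B₀) ⊆ Set.Icc 0 1 := by
  refine spectrum_subset_Icc_of_isPositive ?_ ?_
  · exact ContinuousLinearMap.isPositive_self_comp_adjoint _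
  · refine (ContinuousLinearMap.opNorm_comp_le _ _).trans ?_
    rw [LinearIsometryEquiv.norm_map]
    exact mul_le_one₀ (norm_formInclusion_le α B₀) (norm_nonneg (formInclusion α B₀))
      (norm_formInclusion_le α B₀)

/-- `u = (1 + τ H)⁻¹ h` lies in the form domain and solves `u + τ H u = h` weakly. -/
lemma eulerStep_mem_hamiltonianGraph (α B₀ : ℝ) {τ : ℝ} (hτ : 0 < τ) (h : L2) :
    (eulerStep (resolvent α B₀) τ h, (τ : ℂ)⁻¹ • (h - eulerStep (resolvent α B₀) τ h)) ∈
      hamiltonianGraph α B₀ := by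
  have key := eulerStep_spec (isSelfAdjoint_resolvent α B₀) (spectrum_resolvent_subset α B₀) hτ h
  have hτ' : (τ : ℂ) ≠ 0 := by exact_mod_cast hτ.ne'
  rw [mem_hamiltonianGraph_iff, map_add, map_smul, map_sub, ← key, add_sub_cancel_left,
    inv_smul_smul₀ hτ']
  abel

/-! ### Multiplication operators on `L²` -/

section PointwiseOp

variable {X F G : Type*} [MeasurableSpace X] {μ : Measure X}
  [NormedAddCommGroup F] [NormedSpace ℂ F] [NormedAddCommGroup G] [NormedSpace ℂ G]

/-- The operator `u ↦ (x ↦ m(x) u(x))` from `L²` to `L²` for an essentially bounded family of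
operators `m(x)`. -/
def pointwiseOp (m : X → F →L[ℂ] G) (hm : MemLp m ∞ μ) : Lp F 2 μ →L[ℂ] Lp G 2 μ :=
  (ContinuousLinearMap.id ℂ (F →L[ℂ] G)).holderL μ ∞ 2 2 hm.toLp

lemma coeFn_pointwiseOp (m : X → F →L[ℂ] G) (hm : MemLp m ∞ μ) (u : Lp F 2 μ) :
    pointwiseOp m hm u =ᵐ[μ] fun x => m x (u x) := by
  have h := (ContinuousLinearMap.id ℂ (F →L[ℂ] G)).coeFn_holder (r := 2) hm.toLp u
  filter_upwards [h, hm.coeFn_toLp] with x h1 h2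
  rw [pointwiseOp, ContinuousLinearMap.holderL_apply_apply, h1, h2]
  rfl

/-- Multiplication by a bounded continuous real function on `L²`. -/
def mulOp {a : Plane → ℝ} (ha : Continuous a) (hb : ∃ C, ∀ x, |a x| ≤ C) :
    Lp F 2 (volume : Measure Plane) →L[ℂ] Lp F 2 (volume : Measure Plane) :=
  pointwiseOp (fun x => (a x : ℂ) • ContinuousLinearMap.id ℂ F) <| by
    obtain ⟨C, hC⟩ := hb
    refine memLp_top_of_bound (Continuous.aestronglyMeasurable (by fun_prop))
      (C * ‖ContinuousLinearMap.id ℂ F‖) (Filter.Eventually.of_forall fun x => ?_)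
    rw [norm_smul, Complex.norm_real]
    exact mul_le_mul_of_nonneg_right (hC x) (norm_nonneg _)

lemma coeFn_mulOp {a : Plane → ℝ} (ha : Continuous a) (hb : ∃ C, ∀ x, |a x| ≤ C)
    (u : Lp F 2 (volume : Measure Plane)) :
    mulOp ha hb u =ᵐ[volume] fun x => (a x : ℂ) • u x :=
  coeFn_pointwiseOp _ _ u

end PointwiseOp

/-! ### Localization in the form domain -/

/-- The gradient of a real function, as a complex vector field. -/
def gradC (ψ : Plane → ℝ) (x : Plane) : EuclideanSpace ℂ (Fin 2) :=
  WithLp.toLp 2 fun k => (fderiv ℝ ψ x (EuclideanSpace.single k 1) : ℂ)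

lemma norm_gradC (ψ : Plane → ℝ) (x : Plane) : ‖gradC ψ x‖ = ‖fderiv ℝ ψ x‖ := by
  set v := (InnerProductSpace.toDual ℝ Plane).symm (fderiv ℝ ψ x) with hv
  have h1 : ∀ k, fderiv ℝ ψ x (EuclideanSpace.single k 1) = v k := fun k => by
    rw [← InnerProductSpace.toDual_symm_apply, ← hv]
    simp [EuclideanSpace.inner_single_right]
  rw [← (InnerProductSpace.toDual ℝ Plane).symm.norm_map, ← hv, EuclideanSpace.norm_eq,
    EuclideanSpace.norm_eq]
  simp [gradC, h1]

lemma continuous_gradC {ψ : Plane → ℝ} (hψ : ContDiff ℝ 1 ψ) : Continuous (gradC ψ) := by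
  have := hψ.continuous_fderiv (by simp)
  refine (PiLp.continuous_toLp 2 _).comp (continuous_pi fun k => ?_)
  fun_prop

/-- Multiplication by a smooth function on test functions. -/
def mulTest {ψ : Plane → ℝ} (hψ : ContDiff ℝ (⊤ : ℕ∞) ψ) (φ : 𝓓(puncturedPlane, ℂ)) :
    𝓓(puncturedPlane, ℂ) :=
  ⟨fun x => (ψ x : ℂ) * φ x, (Complex.ofRealCLM.contDiff.comp hψ).mul φ.contDiff,
    φ.hasCompactSupport.mul_left,
    (closure_mono (Function.support_mul_subset_right _ _)).trans φ.tsupport_subset⟩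

lemma magneticGradient_mulTest (α B₀ : ℝ) {ψ : Plane → ℝ} (hψ : ContDiff ℝ (⊤ : ℕ∞) ψ)
    (φ : 𝓓(puncturedPlane, ℂ)) (x : Plane) :
    magneticGradient α B₀ (mulTest hψ φ) x =
      (ψ x : ℂ) • magneticGradient α B₀ φ x + φ x • gradC ψ x := by
  have h1 : HasFDerivAt φ (fderiv ℝ φ x) x :=
    (φ.contDiff.differentiable (by simp) x).hasFDerivAt
  have h2 : HasFDerivAt (fun y => (ψ y : ℂ)) (Complex.ofRealCLM.comp (fderiv ℝ ψ x)) x :=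
    Complex.ofRealCLM.hasFDerivAt.comp x (hψ.differentiable (by simp) x).hasFDerivAt
  have h : (⇑(mulTest hψ φ) : Plane → ℂ) = fun y => (ψ y : ℂ) * φ y := rfl
  have h3 := (h2.mul h1).fderiv
  ext k
  simp only [magneticGradient, h, gradC, PiLp.add_apply, PiLp.smul_apply, smul_eq_mul]
  rw [show fderiv ℝ (fun y => (ψ y : ℂ) * φ y) x = _ from h3]
  simp
  ring

/-- The form domain is stable under multiplication by smooth functions which are bounded together
with their gradient, and the magnetic gradient obeys the product rule. -/
lemma exists_formDomain_mul (α B₀ : ℝ) {ψ : Plane → ℝ} (hψ : ContDiff ℝ (⊤ : ℕ∞) ψ)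
    (hb : ∃ C, ∀ x, |ψ x| ≤ C) (hb' : ∃ C, ∀ x, ‖fderiv ℝ ψ x‖ ≤ C)
    {U : WithLp 2 (L2 × L2Vec)} (hU : U ∈ formDomain α B₀) :
    ∃ V ∈ formDomain α B₀, (V.fst =ᵐ[volume] fun x => (ψ x : ℂ) • U.fst x) ∧
      V.snd =ᵐ[volume] fun x => (ψ x : ℂ) • U.snd x + U.fst x • gradC ψ x := by
  have hgm : MemLp (fun x => (ContinuousLinearMap.id ℂ ℂ).smulRight (gradC ψ x)) ∞
      (volume : Measure Plane) := by
    obtain ⟨C, hC⟩ := hb'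
    have := continuous_gradC (hψ.of_le (by norm_cast))
    refine memLp_top_of_bound (Continuous.aestronglyMeasurable ?_) C
      (Filter.Eventually.of_forall fun x => ?_)
    · exact (ContinuousLinearMap.smulRightL ℂ ℂ (EuclideanSpace ℂ (Fin 2))
        (ContinuousLinearMap.id ℂ ℂ)).continuous.comp this
    · rw [ContinuousLinearMap.norm_smulRight_apply, norm_gradC]
      simpa using hC x
  let T : WithLp 2 (L2 × L2Vec) →L[ℂ] WithLp 2 (L2 × L2Vec) :=
    (WithLp.prodContinuousLinearEquiv 2 ℂ L2 L2Vec).symm.toContinuousLinearMap ∘L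
      (((mulOp hψ.continuous hb).comp (WithLp.fstL 2 ℂ L2 L2Vec)).prod
        ((mulOp hψ.continuous hb).comp (WithLp.sndL 2 ℂ L2 L2Vec) +
          (pointwiseOp _ hgm).comp (WithLp.fstL 2 ℂ L2 L2Vec)))
  have hT1 : ∀ W, (T W).fst = mulOp hψ.continuous hb W.fst := fun W => rfl
  have hT2 : ∀ W, (T W).snd = mulOp hψ.continuous hb W.snd + pointwiseOp _ hgm W.fst :=
    fun W => rfl
  have hTa : ∀ W, (T W).fst =ᵐ[volume] fun x => (ψ x : ℂ) • W.fst x := fun W => by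
    rw [hT1]; exact coeFn_mulOp _ _ _
  have hTb : ∀ W, (T W).snd =ᵐ[volume]
      fun x => (ψ x : ℂ) • W.snd x + W.fst x • gradC ψ x := fun W => by
    rw [hT2]
    filter_upwards [Lp.coeFn_add (mulOp hψ.continuous hb W.snd) (pointwiseOp _ hgm W.fst),
      coeFn_mulOp hψ.continuous hb W.snd, coeFn_pointwiseOp _ hgm W.fst] with x h1 h2 h3
    rw [h1, Pi.add_apply, h2, h3]
    simp
  refine ⟨T U, ?_, hTa U, hTb U⟩
  have hmaps : Set.MapsTo T (LinearMap.range (gradientGraphMap α B₀))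
      (LinearMap.range (gradientGraphMap α B₀)) := by
    rintro _ ⟨φ, rfl⟩
    refine ⟨mulTest hψ φ, ?_⟩
    have e1 := (memLp_testFunction φ).coeFn_toLp
    have e2 := (memLp_magneticGradient α B₀ φ).coeFn_toLp
    apply (WithLp.equiv 2 _).injective
    refine Prod.ext (Lp.ext ?_) (Lp.ext ?_)
    · refine (memLp_testFunction (mulTest hψ φ)).coeFn_toLp.trans
        (Filter.EventuallyEq.symm ((hTa _).trans ?_))
      filter_upwards [e1] with x hx
      exact congrArg (fun z => (ψ x : ℂ) • z) hx
    · refine (memLp_magneticGradient α B₀ (mulTest hψ φ)).coeFn_toLp.trans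
        (Filter.EventuallyEq.symm ((hTb _).trans ?_))
      filter_upwards [e1, e2] with x hx hx2
      rw [magneticGradient_mulTest]
      exact congrArg₂ (fun z w => (ψ x : ℂ) • w + z • gradC ψ x) hx hx2
  exact map_mem_closure T.continuous hU hmaps

/-! ### Exponentially weighted estimates -/

/-- Multiplication by the weight `e^φ` on `L²`. -/
def expWeight {φ : Plane → ℝ} (hφ : Continuous φ) (hb : ∃ C, ∀ x, |φ x| ≤ C) : L2 →L[ℂ] L2 :=
  mulOp (a := fun x => Real.exp (φ x)) (Real.continuous_exp.comp hφ) <| by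
    obtain ⟨C, hC⟩ := hb
    exact ⟨Real.exp C, fun x => by
      rw [Real.abs_exp]; exact Real.exp_le_exp.2 ((le_abs_self _).trans (hC x))⟩

lemma coeFn_expWeight {φ : Plane → ℝ} (hφ : Continuous φ) (hb : ∃ C, ∀ x, |φ x| ≤ C) (u : L2) :
    expWeight hφ hb u =ᵐ[volume] fun x => (Real.exp (φ x) : ℂ) • u x :=
  coeFn_mulOp _ _ u

lemma gradC_exp_two_mul {φ : Plane → ℝ} (hφ : Differentiable ℝ φ) (x : Plane) :
    gradC (fun y => Real.exp (2 * φ y)) x = ((2 * Real.exp (2 * φ x) : ℝ) : ℂ) • gradC φ x := by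
  have h := (((hφ x).hasFDerivAt.const_mul 2).exp).fderiv
  ext k
  simp only [gradC, h, PiLp.smul_apply, smul_apply, smul_eq_mul]
  push_cast
  ring

/-- Completing the square: the loss in the weighted energy is at most `s² |u|²`. -/
lemma re_inner_weighted_add_nonneg {e s : ℝ} (u : ℂ) (p G : EuclideanSpace ℂ (Fin 2))
    (hG : ‖G‖ ≤ s) :
    0 ≤ (⟪((e ^ 2 : ℝ) : ℂ) • p + u • ((2 * e ^ 2 : ℝ) : ℂ) • G, p⟫_ℂ).re +
      s ^ 2 * (⟪(e : ℂ) • u, (e : ℂ) • u⟫_ℂ).re := by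
  have h1 : (⟪(e : ℂ) • u, (e : ℂ) • u⟫_ℂ).re = e ^ 2 * ‖u‖ ^ 2 := by
    have h := inner_self_eq_norm_sq (𝕜 := ℂ) ((e : ℂ) • u)
    rwa [norm_smul, Complex.norm_real, mul_pow, Real.norm_eq_abs, sq_abs] at h
  have h2 : (⟪((e ^ 2 : ℝ) : ℂ) • p + u • ((2 * e ^ 2 : ℝ) : ℂ) • G, p⟫_ℂ).re =
      e ^ 2 * (‖p‖ ^ 2 + 2 * (⟪u • G, p⟫_ℂ).re) := by
    have h : (⟪p, p⟫_ℂ).re = ‖p‖ ^ 2 := inner_self_eq_norm_sq (𝕜 := ℂ) p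
    rw [inner_add_left, smul_comm u, inner_smul_left p, inner_smul_left (u • G),
      Complex.conj_ofReal, Complex.conj_ofReal, Complex.add_re, Complex.re_ofReal_mul,
      Complex.re_ofReal_mul, h]
    ring
  have h3 := norm_add_sq (𝕜 := ℂ) (u • G) p
  rw [norm_smul] at h3
  change _ = _ + 2 * (⟪u • G, p⟫_ℂ).re + _ at h3
  have h4 : (‖u‖ * ‖G‖) ^ 2 ≤ s ^ 2 * ‖u‖ ^ 2 := by
    rw [mul_pow, mul_comm]
    gcongr
  rw [h1, h2]
  have h5 : 0 ≤ ‖p‖ ^ 2 + 2 * (⟪u • G, p⟫_ℂ).re + s ^ 2 * ‖u‖ ^ 2 := by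
    nlinarith [sq_nonneg ‖u • G + p‖]
  nlinarith [mul_nonneg (sq_nonneg e) h5]

/-- The energy estimate `Re ⟨e^φ u, e^φ H u⟩ ≥ -s² ‖e^φ u‖²` for `|∇φ| ≤ s`, obtained by testing
the weak equation with `e^{2φ} u`. -/
lemma neg_le_re_inner_expWeight (α B₀ : ℝ) {φ : Plane → ℝ} (hφ : ContDiff ℝ (⊤ : ℕ∞) φ)
    (hb : ∃ C, ∀ x, |φ x| ≤ C) {s : ℝ} (hs : ∀ x, ‖fderiv ℝ φ x‖ ≤ s) {u w : L2}
    (huw : (u, w) ∈ hamiltonianGraph α B₀) :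
    -(s ^ 2 * ‖expWeight hφ.continuous hb u‖ ^ 2) ≤
      (⟪expWeight hφ.continuous hb u, expWeight hφ.continuous hb w⟫_ℂ).re := by
  obtain ⟨U, hU, hUu, h⟩ := huw
  simp only at hUu h
  set M := expWeight hφ.continuous hb
  have hd : Differentiable ℝ φ := hφ.differentiable (by simp)
  obtain ⟨C, hC⟩ := hb
  have hexp : ∀ x, Real.exp (2 * φ x) ≤ Real.exp (2 * C) := fun x =>
    Real.exp_le_exp.2 (by linarith [le_abs_self (φ x), hC x])
  obtain ⟨V, hV, hV1, hV2⟩ := exists_formDomain_mul α B₀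
    (ψ := fun x => Real.exp (2 * φ x)) (contDiff_const.mul hφ).exp
    ⟨Real.exp (2 * C), fun x => by rw [Real.abs_exp]; exact hexp x⟩
    ⟨2 * Real.exp (2 * C) * s, fun x => by
      rw [← norm_gradC, gradC_exp_two_mul hd, norm_smul, norm_gradC, Complex.norm_real,
        Real.norm_of_nonneg (by positivity)]
      have := hexp x
      gcongr
      exact hs x⟩ hU
  rw [hUu] at hV1 hV2
  have he : ∀ x, Real.exp (2 * φ x) = Real.exp (φ x) ^ 2 := fun x => by
    rw [← Real.exp_nat_mul]; norm_num
  have h1 : ⟪M u, M w⟫_ℂ = ⟪V.fst, w⟫_ℂ := by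
    rw [L2.inner_def, L2.inner_def]
    refine integral_congr_ae ?_
    filter_upwards [hV1, coeFn_expWeight hφ.continuous ⟨C, hC⟩ u,
      coeFn_expWeight hφ.continuous ⟨C, hC⟩ w] with x e1 e2 e3
    rw [e1, e2, e3, inner_smul_left, inner_smul_left, inner_smul_right, he]
    rw [Complex.conj_ofReal, Complex.conj_ofReal, ← mul_assoc, ← Complex.ofReal_mul, sq]
  have h2 : ‖M u‖ ^ 2 = (⟪M u, M u⟫_ℂ).re :=
    (inner_self_eq_norm_sq (𝕜 := ℂ) (M u)).symm
  have hre : ∀ {F : Type} [NormedAddCommGroup F] [InnerProductSpace ℂ F]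
      (v z : Lp F 2 (volume : Measure Plane)), (⟪v, z⟫_ℂ).re = ∫ x, (⟪v x, z x⟫_ℂ).re := by
    intro F _ _ v z
    rw [L2.inner_def]
    exact (integral_re (L2.integrable_inner (𝕜 := ℂ) v z)).symm
  have hint : ∀ {F : Type} [NormedAddCommGroup F] [InnerProductSpace ℂ F]
      (v z : Lp F 2 (volume : Measure Plane)), Integrable fun x => (⟪v x, z x⟫_ℂ).re :=
    fun v z => (L2.integrable_inner (𝕜 := ℂ) v z).re
  rw [h1, ← h V hV, h2, neg_le_iff_add_nonneg, hre, hre, ← integral_const_mul,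
    ← integral_add (hint _ _) ((hint _ _).const_mul _)]
  refine integral_nonneg_of_ae ?_
  filter_upwards [hV2, coeFn_expWeight hφ.continuous ⟨C, hC⟩ u] with x e1 e2
  rw [e1, e2, gradC_exp_two_mul hd, he]
  refine re_inner_weighted_add_nonneg (u x) (U.snd x) (gradC φ x) ?_
  rw [norm_gradC]
  exact hs x

lemma norm_expWeight_eulerStep_le (α B₀ : ℝ) {φ : Plane → ℝ} (hφ : ContDiff ℝ (⊤ : ℕ∞) φ)
    (hb : ∃ C, ∀ x, |φ x| ≤ C) {s : ℝ} (hs : ∀ x, ‖fderiv ℝ φ x‖ ≤ s) {τ : ℝ} (hτ : 0 < τ)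
    (h : L2) :
    (1 - τ * s ^ 2) * ‖expWeight hφ.continuous hb (eulerStep (resolvent α B₀) τ h)‖ ≤
      ‖expWeight hφ.continuous hb h‖ := by
  have key := neg_le_re_inner_expWeight α B₀ hφ hb hs (eulerStep_mem_hamiltonianGraph α B₀ hτ h)
  set M := expWeight hφ.continuous hb
  set u := eulerStep (resolvent α B₀) τ h
  have h1 : (⟪M u, M u⟫_ℂ).re = ‖M u‖ ^ 2 := inner_self_eq_norm_sq (𝕜 := ℂ) (M u)
  rw [map_smul, map_sub, inner_smul_right, inner_sub_right, ← Complex.ofReal_inv,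
    Complex.re_ofReal_mul, Complex.sub_re, h1] at key
  have h2 : (⟪M u, M h⟫_ℂ).re ≤ ‖M u‖ * ‖M h‖ := re_inner_le_norm (𝕜 := ℂ) _ _
  have h3 : (1 - τ * s ^ 2) * ‖M u‖ ^ 2 ≤ ‖M u‖ * ‖M h‖ := by
    have h4 := mul_le_mul_of_nonneg_left key hτ.le
    rw [mul_inv_cancel_left₀ hτ.ne'] at h4
    nlinarith
  rcases (norm_nonneg (M u)).eq_or_lt with h0 | h0
  · rw [← h0, mul_zero]; exact norm_nonneg _
  · nlinarith

/-- The weighted bound `‖e^φ e^{-tH} f‖ ≤ e^{s² t} ‖e^φ f‖` for `|∇φ| ≤ s`. -/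
lemma norm_expWeight_heatSemigroup_le (α B₀ : ℝ) {φ : Plane → ℝ} (hφ : ContDiff ℝ (⊤ : ℕ∞) φ)
    (hb : ∃ C, ∀ x, |φ x| ≤ C) {s : ℝ} (hs : ∀ x, ‖fderiv ℝ φ x‖ ≤ s) {t : ℝ} (ht : 0 < t)
    (f : L2) :
    ‖expWeight hφ.continuous hb (heatSemigroup α B₀ t f)‖ ≤
      Real.exp (s ^ 2 * t) * ‖expWeight hφ.continuous hb f‖ := by
  set M := expWeight hφ.continuous hb
  have hpow : ∀ (τ : ℝ), 0 < τ → 0 ≤ 1 - τ * s ^ 2 → ∀ n : ℕ,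
      (1 - τ * s ^ 2) ^ n * ‖M ((eulerStep (resolvent α B₀) τ ^ n) f)‖ ≤ ‖M f‖ := by
    intro τ hτ hτs n
    induction n with
    | zero => simp
    | succ n ih =>
      rw [pow_succ _ n, pow_succ' (eulerStep _ _) n, mul_assoc]
      refine le_trans (mul_le_mul_of_nonneg_left ?_ (pow_nonneg hτs n)) ih
      exact norm_expWeight_eulerStep_le α B₀ hφ hb hs hτ _
  have hlim1 : Filter.Tendsto
      (fun n : ℕ => ‖M ((eulerStep (resolvent α B₀) (t / n) ^ n) f)‖) Filter.atTop
      (nhds ‖M (heatSemigroup α B₀ t f)‖) := by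
    have h := tendsto_eulerStep_pow (isSelfAdjoint_resolvent α B₀)
      (spectrum_resolvent_subset α B₀) ht
    exact ((M.continuous.tendsto _).comp
      (((ContinuousLinearMap.apply ℂ L2 f).continuous.tendsto _).comp h)).norm
  have hlim2 := (Real.tendsto_one_add_div_pow_exp (-(s ^ 2 * t))).mul hlim1
  have hle := le_of_tendsto hlim2 (b := ‖M f‖) <| by
    -- The resolvent bound can only be iterated while `1 - (t/n) s²` is nonnegative.
    filter_upwards [Filter.eventually_gt_atTop 0, Filter.eventually_ge_atTop ⌈t * s ^ 2⌉₊]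
      with n hn0 hn1
    have hn0' : (0 : ℝ) < n := by exact_mod_cast hn0
    have h1 : t / n * s ^ 2 ≤ 1 := by
      rw [div_mul_eq_mul_div, div_le_one hn0']
      exact Nat.ceil_le.1 hn1
    have h2 := hpow (t / n) (by positivity) (by linarith) n
    rwa [show 1 - t / n * s ^ 2 = 1 + -(s ^ 2 * t) / n by ring] at h2
  rw [Real.exp_neg] at hle
  rwa [inv_mul_le_iff₀ (Real.exp_pos _)] at hle

/-! ### Smooth Lipschitz functions separating two sets -/

section Mollify

variable {E : Type*} [NormedAddCommGroup E] [InnerProductSpace ℝ E] [FiniteDimensional ℝ E]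
  [MeasurableSpace E] [BorelSpace E]

open scoped Convolution ContDiff in
/-- A `1`-Lipschitz function is a uniform limit of smooth `1`-Lipschitz functions: mollify. -/
lemma exists_contDiff_lipschitzWith_approx {f : E → ℝ} (hf : LipschitzWith 1 f) {ε : ℝ}
    (hε : 0 < ε) :
    ∃ g : E → ℝ, ContDiff ℝ ∞ g ∧ LipschitzWith 1 g ∧ ∀ x, |g x - f x| ≤ ε := by
  let χ : ContDiffBump (0 : E) := ⟨ε / 2, ε, half_pos hε, half_lt_self hε⟩
  let ρ : E → ℝ := χ.normed (volume : Measure E)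
  have hρ : ∀ x, Integrable (fun y => ρ y * f (x - y)) := fun x =>
    ((χ.continuous_normed).mul (hf.continuous.comp (by fun_prop))).integrable_of_hasCompactSupport
      (χ.hasCompactSupport_normed.mul_right)
  let g : E → ℝ := ρ ⋆[ContinuousLinearMap.lsmul ℝ ℝ, volume] f
  have hg : ∀ x, g x = ∫ y, ρ y * f (x - y) := fun x => by
    simp [g, convolution_def]
  refine ⟨g, ?_, ?_, fun x => ?_⟩
  · exact χ.hasCompactSupport_normed.contDiff_convolution_left _ χ.contDiff_normed
      hf.continuous.locallyIntegrable
  · refine LipschitzWith.of_dist_le_mul fun x y => ?_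
    rw [hg, hg, dist_eq_norm, ← integral_sub (hρ x) (hρ y)]
    calc _ ≤ ∫ z, ρ z * dist x y := by
          refine norm_integral_le_of_norm_le (χ.integrable_normed.mul_const _)
            (Filter.Eventually.of_forall fun z => ?_)
          rw [← mul_sub, norm_mul, Real.norm_of_nonneg (χ.nonneg_normed z), ← dist_eq_norm]
          refine mul_le_mul_of_nonneg_left ?_ (χ.nonneg_normed z)
          simpa using hf.dist_le_mul (x - z) (y - z)
      _ = _ := by
          rw [integral_mul_const, χ.integral_normed]
          simp
  · rw [← Real.dist_eq]
    refine χ.dist_normed_convolution_le hf.continuous.aestronglyMeasurable fun y hy => ?_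
    have := hf.dist_le_mul y x
    simp only [NNReal.coe_one, one_mul] at this
    exact this.trans (Metric.mem_ball.1 hy).le

end Mollify

/-- The truncated distance to `A`: a bounded `1`-Lipschitz function which vanishes on `A` and is
`d(A, B)` on `B`. -/
lemma exists_lipschitzWith_separating (A B : Set Plane) :
    ∃ ξ : Plane → ℝ, LipschitzWith 1 ξ ∧ (∃ C, ∀ x, |ξ x| ≤ C) ∧ (∀ x ∈ A, ξ x = 0) ∧
      ∀ x ∈ B, ξ x = setDist A B := by
  have hd0 : 0 ≤ setDist A B := Real.sInf_nonneg (by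
    rintro _ ⟨x, -, y, -, rfl⟩; exact dist_nonneg)
  refine ⟨fun x => min (Metric.infDist x A) (setDist A B),
    (Metric.lipschitz_infDist_pt A).min_const _, ⟨setDist A B, fun x => ?_⟩, fun x hx => ?_,
    fun y hy => ?_⟩
  · rw [abs_of_nonneg (le_min Metric.infDist_nonneg hd0)]
    exact min_le_right _ _
  · beta_reduce
    rw [Metric.infDist_zero_of_mem hx, min_eq_left hd0]
  · refine min_eq_right ?_
    rcases A.eq_empty_or_nonempty with rfl | hA
    · simp [setDist]
    · refine (Metric.le_infDist hA).2 fun x hx => ?_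
      refine csInf_le ⟨0, ?_⟩ ⟨x, hx, y, hy, dist_comm y x⟩
      rintro _ ⟨x, -, y, -, rfl⟩; exact dist_nonneg

/-! ### Off-diagonal bounds -/

/-- On functions vanishing off `A`, the operator `e^φ` is bounded by the supremum of `e^φ`
on `A`. -/
lemma norm_expWeight_le_of_ae {φ : Plane → ℝ} (hφ : Continuous φ) (hb : ∃ C, ∀ x, |φ x| ≤ C)
    {A : Set Plane} {f : L2} (hf : ∀ᵐ x, x ∉ A → f x = 0) {c : ℝ} (hc : ∀ x ∈ A, φ x ≤ c) :
    ‖expWeight hφ hb f‖ ≤ Real.exp c * ‖f‖ := by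
  refine Lp.norm_le_mul_norm_of_ae_le_mul ?_
  filter_upwards [hf, coeFn_expWeight hφ hb f] with x h1 h2
  rw [h2, norm_smul, Complex.norm_real, Real.norm_of_nonneg (Real.exp_pos _).le]
  by_cases hx : x ∈ A
  · have := hc x hx
    gcongr
  · simp [h1 hx]

lemma norm_eq_normOn {A : Set Plane} (hA : MeasurableSet A) {f : L2}
    (hf : ∀ᵐ x, x ∉ A → f x = 0) : ‖f‖ = normOn A f := by
  rw [normOn, Lp.norm_def, ← eLpNorm_indicator_eq_eLpNorm_restrict hA]
  congr 1
  refine eLpNorm_congr_ae ?_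
  filter_upwards [hf] with x hx
  by_cases h : x ∈ A
  · simp [h]
  · simp [h, hx h]

lemma inner_expWeight_neg {φ : Plane → ℝ} (hφ : Continuous φ) (hb : ∃ C, ∀ x, |φ x| ≤ C)
    (hb' : ∃ C, ∀ x, |-φ x| ≤ C) (g v : L2) :
    ⟪expWeight hφ.neg hb' g, expWeight hφ hb v⟫_ℂ = ⟪g, v⟫_ℂ := by
  rw [L2.inner_def, L2.inner_def]
  refine integral_congr_ae ?_
  filter_upwards [coeFn_expWeight hφ.neg hb' g, coeFn_expWeight hφ hb v] with x e1 e2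
  rw [e1, e2, inner_smul_left, inner_smul_right, Complex.conj_ofReal, ← mul_assoc,
    ← Complex.ofReal_mul, ← Real.exp_add]
  simp

/-- Davies' method: a smooth `1`-Lipschitz function `η` with `η ≤ ε` on `A` and `η ≥ d - ε`
on `B` gives the off-diagonal bound with weight `e^{s η}`. -/
lemma norm_inner_heatSemigroup_le (α B₀ : ℝ) {A B : Set Plane} {f g : L2}
    (hf : ∀ᵐ x, x ∉ A → f x = 0) (hg : ∀ᵐ x, x ∉ B → g x = 0) {t : ℝ} (ht : 0 < t)
    {η : Plane → ℝ} (hη : ContDiff ℝ (⊤ : ℕ∞) η) (hL : LipschitzWith 1 η)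
    (hb : ∃ C, ∀ x, |η x| ≤ C) {ε d s : ℝ} (hs : 0 ≤ s) (hA : ∀ x ∈ A, η x ≤ ε)
    (hB : ∀ x ∈ B, d - ε ≤ η x) :
    ‖⟪g, heatSemigroup α B₀ t f⟫_ℂ‖ ≤
      ‖f‖ * ‖g‖ * Real.exp (s ^ 2 * t - s * d + 2 * s * ε) := by
  have hφ : ContDiff ℝ (⊤ : ℕ∞) (fun x => s * η x) := contDiff_const.mul hη
  have hφb : ∃ C, ∀ x, |s * η x| ≤ C := by
    obtain ⟨C, hC⟩ := hb
    refine ⟨s * C, fun x => ?_⟩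
    rw [abs_mul, abs_of_nonneg hs]
    exact mul_le_mul_of_nonneg_left (hC x) hs
  have hφb' : ∃ C, ∀ x, |-(s * η x)| ≤ C := by simpa only [abs_neg] using hφb
  have hφs : ∀ x, ‖fderiv ℝ (fun x => s * η x) x‖ ≤ s := fun x => by
    rw [fderiv_const_mul (hη.differentiable (by simp) x), norm_smul, Real.norm_of_nonneg hs]
    have := norm_fderiv_le_of_lipschitz ℝ hL (x₀ := x)
    rw [NNReal.coe_one] at this
    exact mul_le_of_le_one_right hs this
  rw [← inner_expWeight_neg hφ.continuous hφb hφb' g]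
  have h1 := norm_expWeight_heatSemigroup_le α B₀ hφ hφb hφs ht f
  have h2 := norm_expWeight_le_of_ae hφ.continuous hφb hf (c := s * ε)
    fun x hx => mul_le_mul_of_nonneg_left (hA x hx) hs
  have h3 := norm_expWeight_le_of_ae hφ.continuous.neg hφb' hg (c := -(s * (d - ε)))
    fun x hx => neg_le_neg (mul_le_mul_of_nonneg_left (hB x hx) hs)
  calc _ ≤ _ := norm_inner_le_norm _ _
    _ ≤ (Real.exp (-(s * (d - ε))) * ‖g‖) *
          (Real.exp (s ^ 2 * t) * (Real.exp (s * ε) * ‖f‖)) := by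
        gcongr
        exact h1.trans (by gcongr)
    _ = ‖f‖ * ‖g‖ * (Real.exp (-(s * (d - ε))) * Real.exp (s ^ 2 * t) * Real.exp (s * ε)) := by
        ring
    _ = _ := by
        rw [← Real.exp_add, ← Real.exp_add]
        ring_nf

end AharonovBohm

end

theorem mainTheorem4 (α B₀ : ℝ) (hB₀ : 0 < B₀) (A B : Set AharonovBohm.Plane)
    (hA : MeasurableSet A) (hB : MeasurableSet B) (hAB : Disjoint A B)
    (f g : AharonovBohm.L2)
    (hf : ∀ᵐ x, x ∉ A → f x = 0) (hg : ∀ᵐ x, x ∉ B → g x = 0)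
    (t : ℝ) (ht : 0 < t) :
    ‖⟪g, AharonovBohm.heatSemigroup α B₀ t f⟫_ℂ‖ ≤
      AharonovBohm.normOn A f * AharonovBohm.normOn B g *
        Real.exp (-(AharonovBohm.setDist A B ^ 2 / (4 * t))) := by
  rw [← AharonovBohm.norm_eq_normOn hA hf, ← AharonovBohm.norm_eq_normOn hB hg]
  obtain ⟨ξ, hξ, ⟨C, hC⟩, hξA, hξB⟩ := AharonovBohm.exists_lipschitzWith_separating A B
  set d := AharonovBohm.setDist A B with hd
  have hd0 : 0 ≤ d := Real.sInf_nonneg (by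
    rintro _ ⟨x, -, y, -, rfl⟩; exact dist_nonneg)
  -- The exponent `s² t - s d` is minimal at this `s`, with minimum `-d² / (4 t)`.
  let s := d / (2 * t)
  have hs : 0 ≤ s := by positivity
  have hexp : s ^ 2 * t - s * d = -(d ^ 2 / (4 * t)) := by
    simp only [s]; field_simp; ring
  have key : ∀ ε > 0, ‖⟪g, AharonovBohm.heatSemigroup α B₀ t f⟫_ℂ‖ ≤
      ‖f‖ * ‖g‖ * Real.exp (-(d ^ 2 / (4 * t)) + 2 * s * ε) := fun ε hε => by
    obtain ⟨η, hη, hL, hηξ⟩ := AharonovBohm.exists_contDiff_lipschitzWith_approx hξ hε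
    rw [← hexp]
    refine AharonovBohm.norm_inner_heatSemigroup_le α B₀ hf hg ht hη hL
      ⟨C + ε, fun x => ?_⟩ hs (fun x hx => ?_) (fun x hx => ?_)
    · have := abs_add_le (ξ x) (η x - ξ x)
      rw [add_sub_cancel] at this
      linarith [hC x, hηξ x]
    · have := abs_le.1 (hηξ x)
      linarith [hξA x hx]
    · have := abs_le.1 (hηξ x)
      linarith [hξB x hx]
  have hlim : Filter.Tendsto
      (fun ε : ℝ => ‖f‖ * ‖g‖ * Real.exp (-(d ^ 2 / (4 * t)) + 2 * s * ε))
      (nhdsWithin 0 (Set.Ioi 0)) (nhds (‖f‖ * ‖g‖ * Real.exp (-(d ^ 2 / (4 * t))))) := by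
    have hc : Continuous fun ε : ℝ =>
        ‖f‖ * ‖g‖ * Real.exp (-(d ^ 2 / (4 * t)) + 2 * s * ε) := by fun_prop
    simpa using (hc.tendsto 0).mono_left nhdsWithin_le_nhds
  exact ge_of_tendsto hlim (Filter.eventually_of_mem self_mem_nhdsWithin key)
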